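/- All codes are linear array codes: each of finitely many nodes stores $\ell$ symbols of a field ($\ell$ is the sub-packetization). The storage overhead is the total number of stored symbols divided by the number of data symbols (the dimension). The fault tolerance is the largest $t$ such that any $t$ erased nodes can be recovered from the remaining ones. The repair locality is the number of nodes contacted in repairing a single erased node. An $(N,K)$ MDS array code has dimension $K\ell$ and is determined by any $K$ of its $N$ nodes; it is MSR if moreover every node can be repaired from the other nodes by downloading $\frac{(N-1)\ell}{N-K}$ symbols in total (a downloaded symbol being a linear combination of the symbols of one node). **GSRC.** Let $n>k$, $m,a\ge 1$, $q>n\ge m+a$, let $\alpha$ be a primitive element of $\mathbb F_q$. The codewords of the $(n,k,m,a)$-GSRC are the $n\times(m+a)$ arrays (row $j$ is node $j$) with entries $x_{j,t}$ ($0\le t<m$) and $p_{j,i}$ ($0\le i<a$), row indices modulo $n$, such that each column $(x_{0,t},\dots,x_{n-1,t})$ lies in a prescribed $(n,k)$ MDS code over $\mathbb F_q$, and $p_{j,i}=\sum_{t=0}^{m-1}\alpha^{it}x_{j-t-1-i,t}$. It is assumed that the code $\{(x_0,\dots,x_{m-1},y_0,\dots,y_{a-1}) : y_i=\sum_{t}\alpha^{it}x_t\}$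 is an $(m+a,m)$ MDS code. Its repair method for node $f$ reads, for $0\le\delta<m$, the symbols $p_{f+\delta+1,0}$ and $x_{f+\delta-t,t}$ ($t\ne\delta$) to repair $x_{f,\delta}$, and, for $0\le i<a$, the symbols $x_{f-t-1-i,t}$ ($0\le t<m$) to repair $p_{f,i}$. **Locally MSR PMDS code** with parameters $(g,k',r',s)$: $g$ groups of $k'+r'$ nodes, dimension $(gk'-s)\ell$, the nodes of each group form a $(k'+r',k')$ MSR code, and every erasure pattern consisting of at most $r'$ nodes in each group and at most $s$ further nodes is recoverable. A node is repaired inside its group with the MSR bandwidth $\frac{(k'+r'-1)\ell}{r'}$. **Theorem.** Let $r'\ge 2$, $1\le s\le k'$, $g\ge 2$, $a\ge 1$ with $2a\le r'$, $n=g(k'+r')$, $k=n-r'-s$, and suppose that $m=\frac{a(gk'-s)}{gr'-r'}$ is an integer and $g\ge\max\left(\frac{2k'}{r'}+1,\frac{r'+s+a}{2}\right)$. Consider an $(n,k,m,a)$-GSRC, and locally MSR PMDS codes with parameters $(g,k',r',s)$ and sub-packetization $\ell=r'^{\,k'+r'-1}$. Then: 1. The GSRC has the same storage overhead as every such locally MSR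 PMDS code. 2. The sub-packetization $m+a$ of the GSRC is smaller than $a\left(\frac32+\frac{k'}{r'}\right)$, and smaller than $r'^{\,k'+r'-1}$. 3. The fault tolerance of the GSRC is $r'+s+a$. Every locally MSR PMDS code recovers any $r'+s$ erased nodes, and if $s<k'$ its fault tolerance is exactly $r'+s$. 4. The repair method of the GSRC repairs every node, contacting $2m+a-1$ nodes, whereas every repair inside its group of a node of a locally MSR PMDS code with the MSR bandwidth contacts exactly $k'+r'-1$ nodes; and $2m+a-1<k'+r'-1$. -/

import Mathlib

noncomputable section

namespace GSRCode

/-! Linear codes. A code with node set `ι` in which each node stores a vector of `V` is a subspace of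
`ι → V`. For `V = F` this is an ordinary (scalar) code, for `V = κ → F` it is an array code in which
each node stores the symbols indexed by the columns `κ`. -/

section General

variable {F : Type*} [Field F] {ι κ : Type*}
  {V : Type*} [AddCommGroup V] [Module F V]

/-- The erasure of all the nodes in `E` can be corrected: the surviving nodes determine the whole
codeword. -/
def Recoverable (C : Submodule F (ι → V)) (E : Finset ι) : Prop :=
  ∀ c ∈ C, ∀ c' ∈ C, (∀ i, i ∉ E → c i = c' i) → c = c'

/-- Any `t` (or fewer) erased nodes can be recovered. -/
def Tolerates (C : Submodule F (ι → V)) (t : ℕ) : Prop :=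
  ∀ E : Finset ι, E.card ≤ t → Recoverable C E

/-- The fault tolerance is the largest number `t` such that any `t` erased nodes can be recovered. -/
def IsFaultTolerance (C : Submodule F (ι → V)) (t : ℕ) : Prop :=
  IsGreatest {t : ℕ | Tolerates C t} t

/-- `C` is a maximum distance separable code with `k` data nodes: it carries `k` nodes' worth of data
symbols, and any `k` nodes retrieve everything. -/
def IsMDS (C : Submodule F (ι → V)) (k : ℕ) : Prop :=
  Module.finrank F C = k * Module.finrank F V ∧
    ∀ S : Finset ι, S.card = k → ∀ c ∈ C, ∀ c' ∈ C, (∀ i ∈ S, c i = c' i) → c = c'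

/-- The ratio of the total number of stored symbols to the number of data symbols. -/
def storageOverhead [Fintype ι] [Fintype κ] (C : Submodule F (ι → κ → F)) : ℚ :=
  ((Fintype.card ι * Fintype.card κ : ℕ) : ℚ) / (Module.finrank F C : ℚ)

/-- The number of symbols stored in each node. -/
def subpacketization [Fintype κ] (_C : Submodule F (ι → κ → F)) : ℕ := Fintype.card κ

/-- A (linear) set of downloads: a pair `(h, φ)` stands for one symbol `φ (c h)`, a linear
combination of the symbols that are stored in node `h`. -/
abbrev Downloads (F : Type*) [Field F] (ι κ : Type*) : Type _ :=
  Finset (ι × Module.Dual F (κ → F))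

/-- The downloads `D` repair the erased node `f`: nothing is downloaded from `f` itself, and the
downloaded symbols determine the content of `f`. -/
def IsRepair (C : Submodule F (ι → κ → F)) (f : ι) (D : Downloads F ι κ) : Prop :=
  (∀ p ∈ D, p.1 ≠ f) ∧
    ∀ c ∈ C, ∀ c' ∈ C, (∀ p ∈ D, p.2 (c p.1) = p.2 (c' p.1)) → c f = c' f

/-- The number of downloaded symbols. -/
def bandwidth (D : Downloads F ι κ) : ℕ := D.card

open Classical in
/-- The number of nodes that are contacted. -/
def nodesContacted (D : Downloads F ι κ) : ℕ := (D.image Prod.fst).card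

/-- `D` repairs `f` with the minimum storage regenerating bandwidth `d * ℓ / (d - k + 1)`, where `ℓ`
is the sub-packetization and `d = n - 1` is the number of other nodes. -/
def IsMSRRepair [Fintype ι] [Fintype κ] (C : Submodule F (ι → κ → F)) (k : ℕ) (f : ι)
    (D : Downloads F ι κ) : Prop :=
  IsRepair C f D ∧
    bandwidth D * (Fintype.card ι - k) = (Fintype.card ι - 1) * Fintype.card κ

/-- Minimum storage regenerating codes: MDS array codes in which every node can be repaired with the
minimum bandwidth `(n - 1) * ℓ / (n - k)`. -/
def IsMSR [Fintype ι] [Fintype κ] (C : Submodule F (ι → κ → F)) (k : ℕ) : Prop :=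
  IsMDS C k ∧ ∀ f, ∃ D, IsMSRRepair C k f D

end General

/-! Locally MSR PMDS codes: `g` groups of `k' + r'` nodes, each node storing `ℓ` symbols. -/

section PMDS

variable {K : Type*} [Field K] {g k' r' ℓ : ℕ}

/-- The code formed by the nodes of group `i`. -/
def groupCode (C : Submodule K (Fin g × Fin (k' + r') → Fin ℓ → K)) (i : Fin g) :
    Submodule K (Fin (k' + r') → Fin ℓ → K) :=
  C.map (LinearMap.funLeft K (Fin ℓ → K) (fun h : Fin (k' + r') => (i, h)))

/-- Locally MSR partial MDS codes: `(g k' - s) ℓ` data symbols, each group is a `(k' + r', k')` MSR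
code, and all erasures of `r'` nodes in each group together with any further `s` nodes are
correctable. -/
structure IsLocallyMSRPMDS (C : Submodule K (Fin g × Fin (k' + r') → Fin ℓ → K)) (s : ℕ) :
    Prop where
  finrank_eq : Module.finrank K C = (g * k' - s) * ℓ
  group_msr : ∀ i, IsMSR (groupCode C i) k'
  pmds : ∀ E₁ E₂ : Finset (Fin g × Fin (k' + r')),
    (∀ i, (E₁.filter (fun x => x.1 = i)).card ≤ r') → E₂.card ≤ s → Recoverable C (E₁ ∪ E₂)

end PMDS

/-! Generalized simple regenerating codes. The nodes are indexed by `ZMod n`, the columns by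
`Fin m ⊕ Fin a`: `c j (Sum.inl t)` is the symbol `x_{j,t}`, and `c j (Sum.inr i)` is `p_{j,i}`. -/

section GSRC

variable {F : Type*} [Field F]

/-- The code of length `m + a` formed by `x_0, …, x_{m-1}` and the `a` symbols
`∑ t, α ^ (i t) x_t`. -/
def diagonalCode (m a : ℕ) (α : F) : Submodule F (Fin m ⊕ Fin a → F) where
  carrier := {c | ∀ i : Fin a, c (Sum.inr i) =
    ∑ t : Fin m, α ^ ((i : ℕ) * (t : ℕ)) * c (Sum.inl t)}
  add_mem' := by
    intro c d hc hd i
    simp only [Pi.add_apply, hc i, hd i, mul_add, Finset.sum_add_distrib]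
  zero_mem' := by
    intro i
    simp
  smul_mem' := by
    intro b c hc i
    simp only [Pi.smul_apply, smul_eq_mul, hc i, Finset.mul_sum]
    exact Finset.sum_congr rfl fun t _ => by ring

/-- The generalized simple regenerating code: column `t` of the first `m` columns is a codeword of
`col t`, and `p_{j,i} = ∑ t, α ^ (i t) x_{j-t-1-i,t}` with row indices modulo `n`. -/
def gsrc (n m a : ℕ) (α : F) (col : Fin m → Submodule F (ZMod n → F)) :
    Submodule F (ZMod n → Fin m ⊕ Fin a → F) where
  carrier := {c | (∀ t : Fin m, (fun j => c j (Sum.inl t)) ∈ col t) ∧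
    ∀ (j : ZMod n) (i : Fin a), c j (Sum.inr i) =
      ∑ t : Fin m, α ^ ((i : ℕ) * (t : ℕ)) *
        c (j - ((t : ℕ) : ZMod n) - 1 - ((i : ℕ) : ZMod n)) (Sum.inl t)}
  add_mem' := by
    intro c d hc hd
    refine ⟨fun t => (col t).add_mem (hc.1 t) (hd.1 t), fun j i => ?_⟩
    simp only [Pi.add_apply, hc.2 j i, hd.2 j i, mul_add, Finset.sum_add_distrib]
  zero_mem' := by
    refine ⟨fun t => (col t).zero_mem, fun j i => ?_⟩
    simp
  smul_mem' := by
    intro b c hc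
    refine ⟨fun t => (col t).smul_mem b (hc.1 t), fun j i => ?_⟩
    simp only [Pi.smul_apply, smul_eq_mul, hc.2 j i, Finset.mul_sum]
    exact Finset.sum_congr rfl fun t _ => by ring

/-- The positions read by the repair method for node `f`: the symbol `x_{f,δ}` is repaired from
`p_{f+δ+1,0}` and the symbols `x_{f+δ-t,t}` with `t ≠ δ`, and the symbol `p_{f,i}` from the symbols
`x_{f-t-1-i,t}`. -/
def IsRepairPosition {n m a : ℕ} (f : ZMod n) (j : ZMod n) : Fin m ⊕ Fin a → Prop
  | Sum.inl t =>
      (∃ δ : Fin m, δ ≠ t ∧ j = f + ((δ : ℕ) : ZMod n) - ((t : ℕ) : ZMod n)) ∨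
        ∃ i : Fin a, j = f - ((t : ℕ) : ZMod n) - 1 - ((i : ℕ) : ZMod n)
  | Sum.inr i => (i : ℕ) = 0 ∧ ∃ δ : Fin m, j = f + ((δ : ℕ) : ZMod n) + 1

open Classical in
/-- The downloads of the repair method for node `f` of a generalized simple regenerating code. -/
def gsrcRepair (F : Type*) [Field F] (n m a : ℕ) [NeZero n] (f : ZMod n) :
    Downloads F (ZMod n) (Fin m ⊕ Fin a) :=
  (Finset.univ.filter (fun p : ZMod n × (Fin m ⊕ Fin a) => IsRepairPosition f p.1 p.2)).image
    (fun p => (p.1, LinearMap.proj p.2))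

end GSRC

end GSRCode

end

/-!
Every comparison reduces to an erasure or dimension count.

*Fault tolerance of the regenerating code.* The symbols `x_{d-t,t}` and `p_{d+1+i,i}` on a diagonal
form a codeword of an `(m + a, m)` MDS code on the `m + a` consecutive nodes `d - m + 1, …, d + a`.
The columns are decoded from the last one to the first. When the columns after `t` are known, the
diagonal through `x_{j,t}` has unknown symbols only in the nodes `j, …, j + t + a`, so `x_{j,t}` is
recovered if at most `a` of the nodes `j, …, j + m + a - 1` are erased
(`GSRCode.apply_eq_zero_of_window`). If this works for `a` erased nodes `j` out of `r' + s + a`, then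
the `(n, n - r' - s)` column code recovers the rest of the column (`GSRCode.gsrc_recoverable`).
Such nodes exist because the erased nodes are sparse: there are at most `2 g` of them, and
`n = g (k' + r')` with `k' + r' > 2 m + a`, so some window of `2 (m + a - 1)` nodes contains at most
`a` of them. The erased nodes in the first half of this window, together with those that most closely
precede it, are as wanted (`GSRCode.exists_sparse_subset`). Conversely, a minimum weight codeword of
column `0`, placed on the nodes `0, …, r' + s`, has all its parities in the nodes `1, …, r' + s + a`
(`GSRCode.exists_gsrc_not_recoverable`).

*Locally MSR PMDS codes.* If `s < k'`, prescribing zeros at `k'` nodes of all groups but one and at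
`k' - s - 1` nodes of that one leaves a nonzero codeword. It vanishes on the other
groups, which are MDS, so its support has at most `r' + s + 1` nodes
(`GSRCode.IsLocallyMSRPMDS.exists_not_recoverable`). A repair with the MSR bandwidth contacts
all the helpers of its group by the cut-set bound: any `r'` helpers send at least `ℓ` symbols in total
(`GSRCode.IsRepair.card_le`), and at the MSR bandwidth this leaves no helper idle, unless `k' = 1`
(`GSRCode.IsMSRRepair.nodesContacted_eq`). The case `k' = 1` is excluded by the integrality of `m`.

*Parameters.* From `m = a (k' / r' + (k' - s) / (r' (g - 1)))` and `2 k' ≤ r' (g - 1)` one gets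
`2 m r' < a r' + 2 a k'` (`GSRCode.param_lt`), from which the bound on the
sub-packetization and, by `2 a ≤ r'`, the bound `2 m + a < k' + r'` follow.
-/

namespace GSRCode

/-! ### Erasures and MDS codes -/

section General

variable {F : Type*} [Field F] {ι κ : Type*} {V : Type*} [AddCommGroup V] [Module F V]

lemma recoverable_of_eq_zero {C : Submodule F (ι → V)} {E : Finset ι}
    (h : ∀ c ∈ C, (∀ i, i ∉ E → c i = 0) → c = 0) : Recoverable C E := fun c hc c' hc' hcc' =>
  sub_eq_zero.1 <| h (c - c') (C.sub_mem hc hc') fun i hi => by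
    rw [Pi.sub_apply, hcc' i hi, sub_self]

lemma Recoverable.eq_zero {C : Submodule F (ι → V)} {E : Finset ι} (h : Recoverable C E)
    {c : ι → V} (hc : c ∈ C) (h0 : ∀ i, i ∉ E → c i = 0) : c = 0 :=
  h c hc 0 C.zero_mem fun i hi => by rw [h0 i hi, Pi.zero_apply]

lemma Recoverable.mono {C : Submodule F (ι → V)} {E E' : Finset ι} (h : Recoverable C E')
    (hE : E ⊆ E') : Recoverable C E := fun c hc c' hc' hcc' =>
  h c hc c' hc' fun i hi => hcc' i fun hi' => hi (hE hi')

lemma IsMDS.eq_zero {C : Submodule F (ι → V)} {k : ℕ} (hC : IsMDS C k) {c : ι → V} (hc : c ∈ C)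
    {S : Finset ι} (hS : k ≤ S.card) (h0 : ∀ i ∈ S, c i = 0) : c = 0 := by
  obtain ⟨T, hTS, hT⟩ := Finset.exists_subset_card_eq hS
  exact hC.2 T hT c hc 0 C.zero_mem fun i hi => by rw [h0 i (hTS hi), Pi.zero_apply]

lemma isFaultTolerance_of_not_recoverable {C : Submodule F (ι → V)} {t : ℕ} (h : Tolerates C t)
    {E : Finset ι} (hE : E.card ≤ t + 1) (hE' : ¬ Recoverable C E) : IsFaultTolerance C t :=
  ⟨h, fun t' ht' => by
    by_contra hlt
    exact hE' (ht' E (by omega))⟩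

lemma exists_ne_zero_mem_of_finrank_lt {W : Type*} [AddCommGroup W] [Module F W]
    {W' : Type*} [AddCommGroup W'] [Module F W'] [FiniteDimensional F W] [FiniteDimensional F W']
    (C : Submodule F W) (φ : W →ₗ[F] W') (h : Module.finrank F W' < Module.finrank F C) :
    ∃ c ∈ C, c ≠ 0 ∧ φ c = 0 := by
  have hker : LinearMap.ker (φ ∘ₗ C.subtype) ≠ ⊥ := LinearMap.ker_ne_bot_of_finrank_lt h
  obtain ⟨c, hc, hc0⟩ := (Submodule.ne_bot_iff _).1 hker
  exact ⟨c, c.2, fun h0 => hc0 (Subtype.ext h0), hc⟩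

lemma nodesContacted_eq_card_image [DecidableEq ι] (D : Downloads F ι κ) :
    nodesContacted D = (D.image Prod.fst).card := by
  unfold nodesContacted
  congr!

end General

/-! ### Extremal subsets and windows -/

/-- A finite set contains, for each `j` up to its size, a set of `j` elements at which `f` takes its
largest values. -/
lemma exists_subset_card_eq_forall_le {ι β : Type*} [LinearOrder β] [DecidableEq ι] (f : ι → β)
    (V : Finset ι) {j : ℕ} (hj : j ≤ V.card) :
    ∃ T ⊆ V, T.card = j ∧ ∀ v ∈ T, ∀ w ∈ V \ T, f w ≤ f v := by
  induction j with
  | zero => exact ⟨∅, by simp, rfl, by simp⟩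
  | succ j ih =>
    obtain ⟨T, hTV, hT, hmax⟩ := ih (by omega)
    have hne : (V \ T).Nonempty := by
      rw [← Finset.card_pos, Finset.card_sdiff_of_subset hTV]; omega
    obtain ⟨z, hz, hzmax⟩ := Finset.exists_max_image (V \ T) f hne
    have hz' := Finset.mem_sdiff.1 hz
    refine ⟨insert z T, Finset.insert_subset hz'.1 hTV, by
      rw [Finset.card_insert_of_notMem hz'.2, hT], fun v hv w hw => ?_⟩
    have hw' : w ∈ V \ T := by
      simp only [Finset.mem_sdiff, Finset.mem_insert, not_or] at hw ⊢
      exact ⟨hw.1, hw.2.2⟩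
    rcases Finset.mem_insert.1 hv with rfl | hv
    · exact hzmax w hw'
    · exact hmax v hv w hw'

/-- Some `j` elements of `V` have at most the average value of `β` on `V`. -/
lemma exists_subset_card_mul_sum_le {ι : Type*} [DecidableEq ι] (β : ι → ℕ)
    (V : Finset ι) {j : ℕ} (hj : j ≤ V.card) :
    ∃ T ⊆ V, T.card = j ∧ V.card * ∑ v ∈ T, β v ≤ j * ∑ v ∈ V, β v := by
  obtain ⟨T, hTV, hT, hmin⟩ :=
    exists_subset_card_eq_forall_le (fun v => OrderDual.toDual (β v)) V hj
  refine ⟨T, hTV, hT, ?_⟩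
  have h : (V \ T).card * ∑ v ∈ T, β v ≤ T.card * ∑ w ∈ V \ T, β w := by
    calc (V \ T).card * ∑ v ∈ T, β v = ∑ v ∈ T, ∑ w ∈ V \ T, β v := by
          simp [Finset.mul_sum]
      _ ≤ ∑ v ∈ T, ∑ w ∈ V \ T, β w :=
          Finset.sum_le_sum fun v hv => Finset.sum_le_sum fun w hw => hmin v hv w hw
      _ = T.card * ∑ w ∈ V \ T, β w := by simp
  have hc : V.card = (V \ T).card + T.card := (Finset.card_sdiff_add_card_eq_card hTV).symm
  rw [← Finset.sum_sdiff hTV, hc, ← hT]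
  linarith

lemma natCast_injOn_range (n : ℕ) [NeZero n] {l : ℕ} (hl : l ≤ n) :
    Set.InjOn (fun o : ℕ => (o : ZMod n)) (Finset.range l) := by
  intro o ho o' ho' h
  simp only [Finset.coe_range, Set.mem_Iio] at ho ho'
  have := (ZMod.natCast_eq_natCast_iff' o o' n).1 h
  rwa [Nat.mod_eq_of_lt (by omega), Nat.mod_eq_of_lt (by omega)] at this

/-- Averaging over all windows of `l` consecutive residues. -/
lemma exists_window_card_le (n l a : ℕ) [NeZero n] (E : Finset (ZMod n))
    (h : l * E.card < (a + 1) * n) :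
    ∃ x : ZMod n, ((Finset.range l).filter (fun o : ℕ => x + (o : ZMod n) ∈ E)).card ≤ a := by
  by_contra! hcon
  have h1 : (a + 1) * n ≤
      ∑ x : ZMod n, ((Finset.range l).filter (fun o : ℕ => x + (o : ZMod n) ∈ E)).card := by
    calc (a + 1) * n = ∑ x : ZMod n, (a + 1) := by simp [ZMod.card, mul_comm]
      _ ≤ _ := Finset.sum_le_sum fun x _ => hcon x
  have h2 : ∑ x : ZMod n, ((Finset.range l).filter (fun o : ℕ => x + (o : ZMod n) ∈ E)).card
      = l * E.card := by
    simp only [Finset.card_filter]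
    rw [Finset.sum_comm]
    have : ∀ o ∈ Finset.range l, (∑ x : ZMod n, if x + (o : ZMod n) ∈ E then 1 else 0) = E.card := by
      intro o _
      exact (Equiv.sum_comp (Equiv.addRight (o : ZMod n)) fun y => if y ∈ E then 1 else 0).trans
        (by simp)
    rw [Finset.sum_congr rfl this]
    simp
  omega

/-- If `E` is sparse on average, then `a` of its elements `e` are such that the window of `l + 1`
consecutive residues that starts at `e` meets `E` at most `a` times. -/
lemma exists_sparse_subset (n l a : ℕ) [NeZero n] (E : Finset (ZMod n)) (hE : a ≤ E.card)
    (hl : 2 * l ≤ n) (h : 2 * l * E.card < (a + 1) * n) :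
    ∃ G ⊆ E, G.card = a ∧
      ∀ e ∈ G, ((Finset.range (l + 1)).filter (fun o : ℕ => e + (o : ZMod n) ∈ E)).card ≤ a := by
  have hn : 0 < n := Nat.pos_of_ne_zero (NeZero.ne n)
  -- A window of length `2 * l` starting at some `x` meets `E` at most `a` times. The elements in its
  -- first half, and those that precede `x` most closely, are as wanted.
  obtain ⟨x, hx⟩ := exists_window_card_le n (2 * l) a E h
  set pos : ZMod n → ℕ := fun e => (e - x).val with hpos
  have hposx : ∀ e, x + (pos e : ZMod n) = e := fun e => by
    simp [hpos]
  have hposlt : ∀ e, pos e < n := fun e => ZMod.val_lt _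
  have hposinj : Function.Injective pos := fun e e' hee' => by
    rw [← hposx e, ← hposx e', hee']
  set U := E.filter (fun e => pos e < l) with hU
  set V := E.filter (fun e => ¬ pos e < l) with hV
  have hUV : U.card + V.card = E.card := Finset.card_filter_add_card_filter_not _
  have hUa : U.card ≤ a := by
    refine le_trans (Finset.card_le_card_of_injOn pos (fun e he => ?_) hposinj.injOn) hx
    have he' := Finset.mem_filter.1 he
    simp only [Finset.coe_filter, Finset.mem_range, Set.mem_ofPred_eq]
    exact ⟨by omega, by rw [hposx]; exact he'.1⟩
  obtain ⟨T, hTV, hT, hmax⟩ := exists_subset_card_eq_forall_le pos V (j := a - U.card) (by omega)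
  have hdisj : Disjoint U T :=
    (Finset.disjoint_filter_filter_not E E (fun e => pos e < l)).mono_right hTV
  have hUT : (U ∪ T).card = a := by
    rw [Finset.card_union_of_disjoint hdisj, hT]; omega
  refine ⟨U ∪ T, Finset.union_subset (Finset.filter_subset _ _)
    (hTV.trans (Finset.filter_subset _ _)), hUT, fun e he => ?_⟩
  rcases Finset.mem_union.1 he with he | he
  · refine le_trans (Finset.card_le_card_of_injOn (fun o => pos e + o) (fun o ho => ?_)
      (fun o _ o' _ hoo' => Nat.add_left_cancel hoo')) hx
    have ho' := Finset.mem_filter.1 ho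
    have h1 := Finset.mem_range.1 ho'.1
    have h2 := (Finset.mem_filter.1 he).2
    simp only [Finset.coe_filter, Finset.mem_range, Set.mem_ofPred_eq]
    refine ⟨by omega, ?_⟩
    rw [Nat.cast_add, ← add_assoc, hposx]
    exact ho'.2
  · rw [← hUT]
    refine Finset.card_le_card_of_injOn (fun o : ℕ => e + (o : ZMod n)) (fun o ho => ?_)
      (fun o ho o' ho' hoo' => ?_)
    · have ho' := Finset.mem_filter.1 ho
      have h1 := Finset.mem_range.1 ho'.1
      by_contra hnot
      simp only [Finset.coe_union, Set.mem_union, Finset.mem_coe, not_or] at hnot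
      have hge : ¬ pos (e + o) < l := fun hlt => hnot.1 (Finset.mem_filter.2 ⟨ho'.2, hlt⟩)
      have hle : pos (e + o) ≤ pos e := hmax e he _
        (Finset.mem_sdiff.2 ⟨Finset.mem_filter.2 ⟨ho'.2, hge⟩, hnot.2⟩)
      have hval : pos (e + o) = (pos e + o) % n := by
        have : ((pos e + o : ℕ) : ZMod n) = e + o - x := by
          rw [Nat.cast_add, eq_sub_iff_add_eq', ← add_assoc, hposx]
        rw [← ZMod.val_natCast, this]
      have hpe := hposlt e
      rcases lt_or_ge (pos e + o) n with hlt | hge'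
      · rw [Nat.mod_eq_of_lt hlt] at hval
        obtain rfl : o = 0 := by omega
        exact hnot.2 (by simpa using he)
      · -- the window wraps around past `x`
        rw [Nat.mod_eq_sub_mod hge', Nat.mod_eq_of_lt (by omega)] at hval
        omega
    · refine natCast_injOn_range n (l := l + 1) (by omega) ?_ ?_ (add_left_cancel hoo')
      · exact Finset.mem_coe.2 (Finset.mem_filter.1 ho).1
      · exact Finset.mem_coe.2 (Finset.mem_filter.1 ho').1

/-! ### Decoding generalized simple regenerating codes -/

section GSRC

variable {F : Type*} [Field F] {n k m a : ℕ} {α : F} {col : Fin m → Submodule F (ZMod n → F)}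

/-- The symbols `x_{d-t,t}` and `p_{d+1+i,i}` form a codeword of the diagonal code. -/
lemma diagonal_mem_diagonalCode {c : ZMod n → Fin m ⊕ Fin a → F} (hc : c ∈ gsrc n m a α col)
    (d : ZMod n) :
    (Sum.elim (fun t : Fin m => c (d - ((t : ℕ) : ZMod n)) (Sum.inl t))
      (fun i : Fin a => c (d + 1 + ((i : ℕ) : ZMod n)) (Sum.inr i))) ∈ diagonalCode m a α := by
  intro i
  simp only [Sum.elim_inr, Sum.elim_inl]
  rw [hc.2]
  refine Finset.sum_congr rfl fun t _ => ?_
  congr 2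
  ring

/-- If the columns to the right of column `t` vanish, `c` vanishes at the nodes outside `E` and at
most `a` of the nodes `j, …, j + m + a - 1` are in `E`, then the symbol `x_{j,t}` vanishes. -/
lemma apply_eq_zero_of_window (hdiag : IsMDS (diagonalCode m a α) m)
    {E : Finset (ZMod n)} {c : ZMod n → Fin m ⊕ Fin a → F} (hc : c ∈ gsrc n m a α col)
    (h0 : ∀ i, i ∉ E → c i = 0) (t : Fin m)
    (ht : ∀ t' : Fin m, t < t' → ∀ j, c j (Sum.inl t') = 0) (j : ZMod n)
    (hj : ((Finset.range (m + a)).filter (fun o : ℕ => j + (o : ZMod n) ∈ E)).card ≤ a) :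
    c j (Sum.inl t) = 0 := by
  classical
  set v : Fin m ⊕ Fin a → F :=
    Sum.elim (fun t' : Fin m => c (j + ((t : ℕ) : ZMod n) - ((t' : ℕ) : ZMod n)) (Sum.inl t'))
      (fun i : Fin a => c (j + ((t : ℕ) : ZMod n) + 1 + ((i : ℕ) : ZMod n)) (Sum.inr i)) with hv
  have hvmem : v ∈ diagonalCode m a α := diagonal_mem_diagonalCode hc _
  -- the entries of the diagonal that can be nonzero lie in distinct nodes of the window
  have hsupp : ((Finset.univ.filter (fun q => v q ≠ 0))).card ≤ a := by
    refine le_trans (Finset.card_le_card_of_injOn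
      (Sum.elim (fun t' : Fin m => (t : ℕ) - t') (fun i : Fin a => (t : ℕ) + 1 + i))
      (fun q hq => ?_) (fun q hq q' hq' hqq' => ?_)) hj
    · have hq : v q ≠ 0 := by simpa using hq
      rcases q with t' | i
      · have hle : t' ≤ t := by
          by_contra hlt
          exact hq (ht t' (not_le.1 hlt) _)
        have hle' : (t' : ℕ) ≤ t := hle
        simp only [Sum.elim_inl, Finset.coe_filter, Finset.mem_range, Set.mem_ofPred_eq]
        refine ⟨by omega, ?_⟩
        by_contra hE
        apply hq
        rw [Nat.cast_sub hle', ← add_sub_assoc] at hE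
        simp only [hv, Sum.elim_inl, h0 _ hE, Pi.zero_apply]
      · simp only [Sum.elim_inr, Finset.coe_filter, Finset.mem_range, Set.mem_ofPred_eq]
        refine ⟨by omega, ?_⟩
        by_contra hE
        apply hq
        rw [Nat.cast_add, Nat.cast_add, Nat.cast_one, ← add_assoc, ← add_assoc] at hE
        simp only [hv, Sum.elim_inr, h0 _ hE, Pi.zero_apply]
    · have key : ∀ t' : Fin m, v (Sum.inl t') ≠ 0 → (t' : ℕ) ≤ t := by
        intro t' h
        by_contra hlt
        exact h (ht t' (not_le.1 hlt) _)
      have hq : v q ≠ 0 := by simpa using hq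
      have hq' : v q' ≠ 0 := by simpa using hq'
      rcases q with t' | i <;> rcases q' with t'' | i' <;>
        simp only [Sum.elim_inl, Sum.elim_inr] at hqq'
      · have := key _ hq
        have := key _ hq'
        congr 1
        ext
        omega
      · omega
      · omega
      · congr 1
        ext
        omega
  have hcard : (Finset.univ.filter (fun q => v q = 0)).card +
      (Finset.univ.filter (fun q => v q ≠ 0)).card = m + a := by
    rw [Finset.card_filter_add_card_filter_not]
    simp
  have hv0 : v = 0 := hdiag.eq_zero hvmem (S := Finset.univ.filter (fun q => v q = 0)) (by omega)
    (by simp)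
  have := congrFun hv0 (Sum.inl t)
  simpa [hv] using this

lemma gsrc_eq_zero_of_inl {c : ZMod n → Fin m ⊕ Fin a → F}
    (hc : c ∈ gsrc n m a α col) (h : ∀ t j, c j (Sum.inl t) = 0) : c = 0 := by
  funext j q
  rcases q with t | i
  · exact h t j
  · rw [hc.2 j i]
    simp [h]

/-- The columns are decoded from the last one to the first: in each of them, the symbols in the nodes
of `G` are recovered along diagonals, and then the column code recovers the others. -/
lemma gsrc_recoverable [NeZero n] (hcol : ∀ t, IsMDS (col t) k)
    (hdiag : IsMDS (diagonalCode m a α) m) {E G : Finset (ZMod n)} (hGE : G ⊆ E)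
    (hG : ∀ e ∈ G, ((Finset.range (m + a)).filter (fun o : ℕ => e + (o : ZMod n) ∈ E)).card ≤ a)
    (hk : k + E.card ≤ n + G.card) : Recoverable (gsrc n m a α col) E := by
  classical
  refine recoverable_of_eq_zero fun c hc h0 => gsrc_eq_zero_of_inl hc fun t => ?_
  induction t using WellFoundedGT.induction with
  | ind t ih =>
    have hz : (fun j => c j (Sum.inl t)) = 0 := by
      refine (hcol t).eq_zero (hc.1 t) (S := (E \ G)ᶜ) ?_ fun j hj => ?_
      · rw [Finset.card_compl, ZMod.card, Finset.card_sdiff_of_subset hGE]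
        have := Finset.card_le_card hGE
        omega
      · by_cases hjE : j ∈ E
        · have hjG : j ∈ G := by simpa [hjE] using hj
          exact apply_eq_zero_of_window hdiag hc h0 t ih j (hG j hjG)
        · rw [h0 j hjE, Pi.zero_apply]
    exact fun j => congrFun hz j

lemma gsrc_tolerates [NeZero n] {r : ℕ} (hcol : ∀ t, IsMDS (col t) k)
    (hdiag : IsMDS (diagonalCode m a α) m) (hm : 1 ≤ m) (hkr : k + r = n) (hra : r + a ≤ n)
    (hn : 2 * (m + a - 1) ≤ n) (hcount : 2 * (m + a - 1) * (r + a) < (a + 1) * n) :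
    Tolerates (gsrc n m a α col) (r + a) := by
  intro E hE
  obtain ⟨E', hEE', -, hE'⟩ := Finset.exists_subsuperset_card_eq (Finset.subset_univ E) hE
    (by rwa [Finset.card_univ, ZMod.card])
  obtain ⟨G, hGE, hGa, hG⟩ := exists_sparse_subset n (m + a - 1) a E' (by omega) hn (by rwa [hE'])
  rw [show m + a - 1 + 1 = m + a by omega] at hG
  exact (gsrc_recoverable hcol hdiag hGE hG (by omega)).mono hEE'

/-- The codeword whose message columns are `x`. -/
def gsrcWord (n m a : ℕ) (α : F) (x : Fin m → ZMod n → F) : ZMod n → Fin m ⊕ Fin a → F :=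
  fun j => Sum.elim (fun t => x t j) fun i => ∑ t : Fin m, α ^ ((i : ℕ) * (t : ℕ)) *
    x t (j - ((t : ℕ) : ZMod n) - 1 - ((i : ℕ) : ZMod n))

lemma gsrcWord_mem {x : Fin m → ZMod n → F} (hx : ∀ t, x t ∈ col t) :
    gsrcWord n m a α x ∈ gsrc n m a α col :=
  ⟨hx, fun _ _ => rfl⟩

/-- A codeword of the first column that is supported in the nodes `0, …, r` extends to a codeword of
the array code that is supported in the nodes `0, …, r + a`. -/
lemma exists_gsrc_not_recoverable [NeZero n] {r : ℕ} (hcol : ∀ t, IsMDS (col t) k)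
    (hm : 1 ≤ m) (hkr : k + r = n) (hk : 1 ≤ k) :
    ∃ E : Finset (ZMod n), E.card ≤ r + a + 1 ∧ ¬ Recoverable (gsrc n m a α col) E := by
  classical
  set A : Finset (ZMod n) := (Finset.range (r + 1)).image (fun o : ℕ => (o : ZMod n)) with hA
  set E : Finset (ZMod n) := (Finset.range (r + a + 1)).image (fun o : ℕ => (o : ZMod n)) with hE
  have hAcard : A.card = r + 1 := by
    rw [hA, Finset.card_image_of_injOn (natCast_injOn_range n (by omega)), Finset.card_range]
  refine ⟨E, Finset.card_image_le.trans (by simp), fun hrec => ?_⟩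
  set t₀ : Fin m := ⟨0, hm⟩ with ht₀
  obtain ⟨y, hy, hy0, hyA⟩ := exists_ne_zero_mem_of_finrank_lt (col t₀)
    (LinearMap.funLeft F F (Subtype.val : {j // j ∈ Aᶜ} → ZMod n)) (by
      rw [(hcol t₀).1, Module.finrank_self, Module.finrank_fintype_fun_eq_card,
        Fintype.card_coe, Finset.card_compl, ZMod.card, hAcard]
      omega)
  have hyA' : ∀ j, j ∉ A → y j = 0 := fun j hj =>
    congrFun hyA ⟨j, Finset.mem_compl.2 hj⟩
  have hmem : gsrcWord n m a α (fun t => if t = t₀ then y else 0) ∈ gsrc n m a α col := by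
    refine gsrcWord_mem fun t => ?_
    by_cases ht : t = t₀
    · subst ht; simpa using hy
    · simp [ht]
  have hz := hrec.eq_zero hmem fun j hj => by
    funext q
    rcases q with t | i
    · by_cases ht : t = t₀
      · simp only [gsrcWord, Sum.elim_inl, ht, if_true, Pi.zero_apply]
        refine hyA' j fun hjA => hj ?_
        obtain ⟨o, ho, rfl⟩ := Finset.mem_image.1 hjA
        exact Finset.mem_image_of_mem _ (Finset.mem_range.2 (by
          have := Finset.mem_range.1 ho; omega))
      · simp [gsrcWord, ht]
    · simp only [gsrcWord, Sum.elim_inr, Pi.zero_apply]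
      refine Finset.sum_eq_zero fun t _ => ?_
      by_cases ht : t = t₀
      · rw [if_pos ht, hyA', mul_zero]
        intro hjA
        obtain ⟨o, ho, hoj⟩ := Finset.mem_image.1 hjA
        refine hj (Finset.mem_image.2 ⟨o + 1 + i, Finset.mem_range.2 ?_, ?_⟩)
        · have := Finset.mem_range.1 ho
          omega
        · have ht' : ((t : ℕ) : ZMod n) = 0 := by rw [ht, ht₀]; simp
          push_cast
          linear_combination hoj - ht'
      · simp [ht]
  apply hy0
  funext j
  have := congrFun (congrFun hz j) (Sum.inl t₀)
  simpa [gsrcWord] using this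

lemma finrank_gsrc [NeZero n] (hcol : ∀ t, IsMDS (col t) k) :
    Module.finrank F (gsrc n m a α col) = m * k := by
  let e : gsrc n m a α col ≃ₗ[F] (∀ t, col t) :=
    { toFun := fun c t => ⟨fun j => c.1 j (Sum.inl t), c.2.1 t⟩
      map_add' := fun _ _ => rfl
      map_smul' := fun _ _ => rfl
      invFun := fun x => ⟨gsrcWord n m a α fun t => x t, gsrcWord_mem fun t => (x t).2⟩
      left_inv := fun c => by
        refine Subtype.ext (funext fun j => funext fun q => ?_)
        rcases q with t | i
        · rfl
        · exact (c.2.2 j i).symm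
      right_inv := fun _ => rfl }
  rw [e.finrank_eq, Module.finrank_pi_fintype]
  simp [(hcol _).1]

/-! ### The repair method -/

lemma mem_gsrcRepair [NeZero n] {f j : ZMod n} {q : Fin m ⊕ Fin a} (h : IsRepairPosition f j q) :
    ((j, LinearMap.proj q) : ZMod n × Module.Dual F (Fin m ⊕ Fin a → F)) ∈
      gsrcRepair F n m a f := by
  classical
  unfold gsrcRepair
  exact Finset.mem_image.2 ⟨(j, q), by simpa using h, rfl⟩

/-- The contacted nodes are `f - (m + a - 1), …, f - 1` and `f + 1, …, f + m`. -/
lemma image_fst_gsrcRepair [NeZero n] [DecidableEq (ZMod n)] (hm : 1 ≤ m) (ha : 1 ≤ a)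
    (f : ZMod n) :
    (gsrcRepair F n m a f).image Prod.fst =
      ((Finset.range (2 * m + a)).erase (m + a - 1)).image
        (fun o : ℕ => (o : ZMod n) + (f - ((m + a - 1 : ℕ) : ZMod n))) := by
  classical
  ext j
  have hmem : j ∈ (gsrcRepair F n m a f).image Prod.fst ↔
      ∃ q : Fin m ⊕ Fin a, IsRepairPosition f j q := by
    unfold gsrcRepair
    simp only [Finset.mem_image, Finset.mem_filter, Finset.mem_univ, true_and]
    constructor
    · rintro ⟨_, ⟨⟨j, q⟩, h, rfl⟩, rfl⟩
      exact ⟨q, h⟩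
    · rintro ⟨q, h⟩
      exact ⟨_, ⟨(j, q), h, rfl⟩, rfl⟩
  rw [hmem]
  simp only [Finset.mem_image, Finset.mem_erase, Finset.mem_range]
  have hcast : ((m + a - 1 : ℕ) : ZMod n) = (m : ZMod n) + a - 1 := by
    rw [Nat.cast_sub (by omega)]; push_cast; ring
  constructor
  · rintro ⟨t | i, h⟩
    · rcases h with ⟨δ, hδ, rfl⟩ | ⟨i, rfl⟩
      · have hδ' : (δ : ℕ) ≠ t := fun h => hδ (Fin.ext h)
        refine ⟨m + a - 1 + δ - t, ⟨by omega, by omega⟩, ?_⟩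
        rw [Nat.cast_sub (by omega), Nat.cast_add]
        ring
      · refine ⟨m + a - 1 - (t + 1 + i), ⟨by omega, by omega⟩, ?_⟩
        rw [Nat.cast_sub (by omega)]
        push_cast
        ring
    · obtain ⟨-, δ, rfl⟩ := h
      refine ⟨m + a - 1 + δ + 1, ⟨by omega, by omega⟩, ?_⟩
      push_cast
      ring
  · rintro ⟨o, ⟨ho, ho'⟩, rfl⟩
    rcases lt_or_ge o (m + a - 1) with hlt | hge
    · -- `o = m + a - 1 - (t + 1 + i)` with `t = min (m - 1) (m + a - 2 - o)`
      by_cases hoa : m + a - 2 - o < m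
      · refine ⟨Sum.inl ⟨m + a - 2 - o, hoa⟩, Or.inr ⟨⟨0, ha⟩, ?_⟩⟩
        have : m + a - 1 = (m + a - 2 - o) + 1 + o := by omega
        rw [this]
        push_cast
        ring
      · refine ⟨Sum.inl ⟨m - 1, by omega⟩, Or.inr ⟨⟨a - 1 - o, by omega⟩, ?_⟩⟩
        have : m + a - 1 = (m - 1) + 1 + (a - 1 - o) + o := by omega
        rw [this]
        push_cast
        ring
    · refine ⟨Sum.inr ⟨0, ha⟩, rfl, ⟨o - (m + a), by omega⟩, ?_⟩
      have : o = o - (m + a) + 1 + (m + a - 1) := by omega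
      conv_lhs => rw [this]
      push_cast
      ring

lemma nodesContacted_gsrcRepair [NeZero n] (hm : 1 ≤ m) (ha : 1 ≤ a) (hn : 2 * m + a ≤ n)
    (f : ZMod n) : nodesContacted (gsrcRepair F n m a f) = 2 * m + a - 1 := by
  rw [nodesContacted_eq_card_image, image_fst_gsrcRepair hm ha, Finset.card_image_of_injOn,
    Finset.card_erase_of_mem (Finset.mem_range.2 (by omega)), Finset.card_range]
  intro o ho o' ho' h
  exact natCast_injOn_range n hn (Finset.mem_of_mem_erase ho) (Finset.mem_of_mem_erase ho')
    (add_right_cancel h)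

lemma isRepair_gsrcRepair [NeZero n] (hm : 1 ≤ m) (ha : 1 ≤ a) (hn : 2 * m + a ≤ n)
    (f : ZMod n) : IsRepair (gsrc n m a α col) f (gsrcRepair F n m a f) := by
  classical
  refine ⟨fun p hp hpf => ?_, fun c hc c' hc' h => ?_⟩
  · have hf := Finset.mem_image_of_mem Prod.fst hp
    rw [image_fst_gsrcRepair hm ha, hpf] at hf
    obtain ⟨o, ho, hof⟩ := Finset.mem_image.1 hf
    have ho' := Finset.mem_erase.1 ho
    refine ho'.1 (natCast_injOn_range n hn ho'.2
      (Finset.mem_coe.2 (Finset.mem_range.2 (by omega))) ?_)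
    linear_combination hof
  · have hpos : ∀ j q, IsRepairPosition f j q → c j q = c' j q := fun j q hq => by
      simpa using h _ (mem_gsrcRepair hq)
    funext q
    rcases q with δ | i
    · have e := hc.2 (f + ((δ : ℕ) : ZMod n) + 1) ⟨0, ha⟩
      have e' := hc'.2 (f + ((δ : ℕ) : ZMod n) + 1) ⟨0, ha⟩
      rw [hpos _ (Sum.inr ⟨0, ha⟩) ⟨rfl, δ, rfl⟩, e'] at e
      have hrow : ∀ t : Fin m, f + ((δ : ℕ) : ZMod n) + 1 - ((t : ℕ) : ZMod n) - 1 -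
          (((⟨0, ha⟩ : Fin a) : ℕ) : ZMod n) =
          f + ((δ : ℕ) : ZMod n) - ((t : ℕ) : ZMod n) := fun t => by
        push_cast; ring
      simp only [hrow, zero_mul, pow_zero, one_mul] at e
      rw [← Finset.add_sum_erase _ _ (Finset.mem_univ δ),
        ← Finset.add_sum_erase _ _ (Finset.mem_univ δ),
        Finset.sum_congr rfl fun t ht => hpos _ (Sum.inl t)
          (Or.inl ⟨δ, (Finset.ne_of_mem_erase ht).symm, rfl⟩)] at e
      simpa using (add_right_cancel e).symm
    · rw [hc.2 f i, hc'.2 f i]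
      exact Finset.sum_congr rfl fun t _ => by
        rw [hpos _ (Sum.inl t) (Or.inr ⟨i, rfl⟩)]

end GSRC

/-! ### Repair bandwidth of MDS array codes -/

section MSR

variable {K : Type*} [Field K] {ι κ : Type*} [Fintype ι] [Fintype κ] {k : ℕ}
  {C : Submodule K (ι → κ → K)}

/-- The cut-set bound: the downloads from any `|ι| - k` of the other nodes number at least one node's
worth of symbols, since the remaining `k - 1` nodes carry no information on the erased one. -/
lemma IsRepair.card_le [DecidableEq ι] (hC : IsMDS C k) (hk : 1 ≤ k) {f : ι}
    {R : Downloads K ι κ} (hR : IsRepair C f R) {B : Finset ι} (hfB : f ∉ B)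
    (hB : B.card + k = Fintype.card ι) :
    Fintype.card κ ≤ (R.filter (fun p => p.1 ∈ B)).card := by
  classical
  by_contra! hlt
  set A : Finset ι := (insert f B)ᶜ with hA
  have hAcard : A.card = k - 1 := by
    rw [hA, Finset.card_compl, Finset.card_insert_of_notMem hfB]; omega
  set R' := R.filter (fun p => p.1 ∈ B) with hR'
  obtain ⟨c, hc, hc0, hφ⟩ := exists_ne_zero_mem_of_finrank_lt C
    ((LinearMap.funLeft K (κ → K) (Subtype.val : {j // j ∈ A} → ι)).prod
      (LinearMap.pi fun p : {p // p ∈ R'} => p.1.2 ∘ₗ LinearMap.proj p.1.1)) (by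
    rw [hC.1, Module.finrank_prod, Module.finrank_pi_fintype]
    simp only [Module.finrank_fintype_fun_eq_card, Finset.sum_const, Finset.card_univ,
      Fintype.card_coe, smul_eq_mul, hAcard]
    obtain ⟨k, rfl⟩ := Nat.exists_eq_add_of_le hk
    rw [Nat.add_sub_cancel_left, add_mul, one_mul]
    omega)
  have hcA : ∀ j ∈ A, c j = 0 := fun j hj => congrFun (congrArg Prod.fst hφ) ⟨j, hj⟩
  have hcB : ∀ p ∈ R', p.2 (c p.1) = 0 := fun p hp => congrFun (congrArg Prod.snd hφ) ⟨p, hp⟩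
  have hcf : c f = 0 := by
    have := hR.2 c hc 0 C.zero_mem fun p hp => by
      rw [Pi.zero_apply, map_zero]
      by_cases hpB : p.1 ∈ B
      · exact hcB p (Finset.mem_filter.2 ⟨hp, hpB⟩)
      · rw [hcA p.1 (by simp [hA, hR.1 p hp, hpB]), map_zero]
    simpa using this
  refine hc0 (hC.eq_zero hc (S := insert f A) ?_ fun j hj => ?_)
  · rw [Finset.card_insert_of_notMem (by simp [hA]), hAcard]; omega
  · rcases Finset.mem_insert.1 hj with rfl | hj
    · exact hcf
    · exact hcA j hj

/-- A repair with the minimum bandwidth contacts all the other nodes. For `k = 1` this fails: a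
repetition code can be repaired by a full copy of one node. -/
lemma IsMSRRepair.nodesContacted_eq (hC : IsMDS C k) (hk : 2 ≤ k) (hkι : k < Fintype.card ι)
    (hκ : 0 < Fintype.card κ) {f : ι} {R : Downloads K ι κ} (hR : IsMSRRepair C k f R) :
    nodesContacted R = Fintype.card ι - 1 := by
  classical
  set O : Finset ι := Finset.univ.erase f with hO
  have hOcard : O.card = Fintype.card ι - 1 := by
    rw [hO, Finset.card_erase_of_mem (Finset.mem_univ f), Finset.card_univ]
  have himage : R.image Prod.fst = O := by
    refine Finset.Subset.antisymm (fun j hj => ?_) (fun h₀ hh₀ => ?_)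
    · obtain ⟨p, hp, rfl⟩ := Finset.mem_image.1 hj
      simpa [hO] using hR.1.1 p hp
    · by_contra hnot
      -- Some `|ι| - k - 1` of the nodes other than `f` and `h₀` send at most their average share;
      -- with `h₀`, which sends nothing, they violate the cut-set bound.
      set β : ι → ℕ := fun j => (R.filter (fun p => p.1 = j)).card with hβ
      have hβ₀ : β h₀ = 0 := by
        rw [hβ, Finset.card_eq_zero, Finset.filter_eq_empty_iff]
        exact fun p hp hp' => hnot (Finset.mem_image.2 ⟨p, hp, hp'⟩)
      have hsum : ∀ B : Finset ι, (R.filter (fun p => p.1 ∈ B)).card = ∑ j ∈ B, β j := by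
        intro B
        rw [Finset.card_eq_sum_card_fiberwise (s := R.filter (fun p => p.1 ∈ B)) (f := Prod.fst)
          (t := B) (fun p hp => (Finset.mem_filter.1 (Finset.mem_coe.1 hp)).2)]
        refine Finset.sum_congr rfl fun j hj => ?_
        rw [hβ, Finset.filter_filter]
        congr 1
        refine Finset.filter_congr fun p _ => ⟨fun h => h.2, fun h => ⟨h ▸ hj, h⟩⟩
      have hcardO' : (O.erase h₀).card = Fintype.card ι - 2 := by
        rw [Finset.card_erase_of_mem hh₀, hOcard]; omega
      have hfh₀ : f ≠ h₀ := fun h => by simp [hO, h] at hh₀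
      have htot : ∑ j ∈ O.erase h₀, β j = R.card := by
        rw [← hsum, Finset.filter_true_of_mem]
        intro p hp
        refine Finset.mem_erase.2 ⟨fun h => hnot (Finset.mem_image.2 ⟨p, hp, h⟩), ?_⟩
        simpa [hO] using hR.1.1 p hp
      obtain ⟨B, hBO, hBcard, hB⟩ := exists_subset_card_mul_sum_le β (O.erase h₀)
        (j := Fintype.card ι - k - 1) (by omega)
      have hh₀B : h₀ ∉ B := fun h => by simpa using hBO h
      have hfB : f ∉ insert h₀ B := by
        intro h
        rcases Finset.mem_insert.1 h with h | h
        · exact hfh₀ h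
        · have := Finset.mem_of_mem_erase (hBO h)
          simp [hO] at this
      have hcut := hR.1.card_le hC (by omega) hfB (by
        rw [Finset.card_insert_of_notMem hh₀B]; omega)
      rw [hsum, Finset.sum_insert hh₀B, hβ₀, zero_add] at hcut
      have hbw : R.card * (Fintype.card ι - k) = (Fintype.card ι - 1) * Fintype.card κ := hR.2
      rw [htot, hcardO'] at hB
      obtain ⟨d, hd⟩ := Nat.exists_eq_add_of_lt hkι
      obtain ⟨b, rfl⟩ := Nat.exists_eq_add_of_le hk
      have e1 : Fintype.card ι - (2 + b) = d + 1 := by omega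
      have e2 : Fintype.card ι - 1 = b + d + 2 := by omega
      have e3 : Fintype.card ι - 2 = b + d + 1 := by omega
      have e4 : Fintype.card ι - (2 + b) - 1 = d := by omega
      rw [e1, e2] at hbw
      rw [e3, e4] at hB
      have h1 : (b + d + 1) * Fintype.card κ ≤ d * R.card :=
        (Nat.mul_le_mul_left _ hcut).trans hB
      have h2 : (b + d + 1) * Fintype.card κ * (d + 1) ≤ d * ((b + d + 2) * Fintype.card κ) := by
        rw [← hbw, ← mul_assoc]
        exact Nat.mul_le_mul_right _ h1
      nlinarith [Nat.zero_le (b * Fintype.card κ)]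
  rw [nodesContacted_eq_card_image, himage, hOcard]

end MSR

/-! ### Locally MSR PMDS codes -/

section PMDS

variable {K : Type*} [Field K] {g k' r' ℓ s : ℕ}
  {D : Submodule K (Fin g × Fin (k' + r') → Fin ℓ → K)}

lemma IsLocallyMSRPMDS.tolerates (hD : IsLocallyMSRPMDS D s) : Tolerates D (r' + s) := by
  classical
  intro E hE
  obtain ⟨E₁, hE₁, hcard⟩ := Finset.exists_subset_card_eq (min_le_right r' E.card)
  rw [← Finset.union_sdiff_of_subset hE₁]
  refine hD.pmds E₁ (E \ E₁) (fun i => (Finset.card_filter_le _ _).trans (by omega)) ?_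
  rw [Finset.card_sdiff_of_subset hE₁]
  omega

/-- Some `r' + s + 1` erasures in a single group cannot be corrected: some nonzero codeword
vanishes at the other `k' - s - 1` nodes of that group and at `k'` nodes of every other group, since
these are only `g k' - s - 1` nodes in total. -/
lemma IsLocallyMSRPMDS.exists_not_recoverable (hD : IsLocallyMSRPMDS D s) (hg : 1 ≤ g)
    (hs : s < k') (hℓ : 0 < ℓ) :
    ∃ E : Finset (Fin g × Fin (k' + r')), E.card ≤ r' + s + 1 ∧ ¬ Recoverable D E := by
  classical
  set i₀ : Fin g := ⟨0, hg⟩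
  let pos : {i : Fin g // i ≠ i₀} × Fin k' ⊕ Fin (k' - s - 1) → Fin g × Fin (k' + r') :=
    Sum.elim (fun q => (q.1, Fin.castAdd r' q.2)) fun h => (i₀, Fin.castLE (by omega) h)
  obtain ⟨c, hc, hc0, hφ⟩ := exists_ne_zero_mem_of_finrank_lt D
    (LinearMap.funLeft K (Fin ℓ → K) pos) (by
      rw [hD.finrank_eq, Module.finrank_pi_fintype]
      simp only [Module.finrank_fintype_fun_eq_card, Fintype.card_fin, Finset.sum_const,
        Finset.card_univ, smul_eq_mul]
      refine Nat.mul_lt_mul_of_pos_right ?_ hℓ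
      rw [Fintype.card_sum, Fintype.card_prod, Fintype.card_fin, Fintype.card_fin,
        Fintype.card_subtype_compl, Fintype.card_fin, Fintype.card_subtype_eq]
      obtain ⟨g, rfl⟩ := Nat.exists_eq_add_of_le hg
      rw [Nat.add_sub_cancel_left, add_mul, one_mul]
      omega)
  -- `c` vanishes at `k'` nodes of each group but one, hence on these whole groups
  have hother : ∀ i, i ≠ i₀ → ∀ h, c (i, h) = 0 := by
    intro i hi h
    have hz : (fun h => c (i, h)) = 0 := by
      refine (hD.group_msr i).1.eq_zero (Submodule.mem_map_of_mem hc)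
        (S := Finset.univ.image (Fin.castAdd r')) ?_ fun h hh => ?_
      · rw [Finset.card_image_of_injective _ (Fin.castAdd_injective k' r')]
        simp
      · obtain ⟨h', -, rfl⟩ := Finset.mem_image.1 hh
        exact congrFun hφ (Sum.inl (⟨i, hi⟩, h'))
    exact congrFun hz h
  refine ⟨(Finset.univ.filter (fun h : Fin (k' + r') => k' - s - 1 ≤ (h : ℕ))).image
    (fun h => (i₀, h)), Finset.card_image_le.trans ?_, fun hrec => hc0 (hrec.eq_zero hc ?_)⟩
  · rw [← Finset.card_map Fin.valEmbedding]
    refine (Finset.card_le_card (t := Finset.Ico (k' - s - 1) (k' + r')) fun x hx => ?_).trans ?_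
    · obtain ⟨h, hh, rfl⟩ := Finset.mem_map.1 hx
      exact Finset.mem_Ico.2 ⟨(Finset.mem_filter.1 hh).2, h.2⟩
    · rw [Nat.card_Ico]; omega
  · rintro ⟨i, h⟩ hih
    by_cases hi : i = i₀
    · subst hi
      have hh : (h : ℕ) < k' - s - 1 := by
        by_contra hge
        exact hih (Finset.mem_image.2 ⟨h, Finset.mem_filter.2 ⟨Finset.mem_univ _, by omega⟩, rfl⟩)
      exact congrFun hφ (Sum.inr ⟨h, hh⟩)
    · exact hother i hi h

end PMDS

/-! ### Parameters -/

section Parameters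

variable {g k' r' s m a : ℕ}

lemma param_relation (hr' : 2 ≤ r') (hg : 2 ≤ g)
    (hm : (m : ℚ) = a * (g * k' - s) / (g * r' - r')) :
    m * (g * r') + a * s = a * (g * k') + m * r' := by
  have hg' : (2 : ℚ) ≤ g := by exact_mod_cast hg
  have hr : (2 : ℚ) ≤ r' := by exact_mod_cast hr'
  have hpos : (0 : ℚ) < g * r' - r' := by nlinarith
  rw [eq_div_iff hpos.ne'] at hm
  have : (m : ℚ) * (g * r') + a * s = a * (g * k') + m * r' := by linarith
  exact_mod_cast this

/-- `m = a (k' / r' + (k' - s) / (r' (g - 1)))`, and `2 k' ≤ r' (g - 1)`. -/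
lemma param_lt (hs : 1 ≤ s) (hg : 2 ≤ g) (ha : 1 ≤ a)
    (hrel : m * (g * r') + a * s = a * (g * k') + m * r') (hgk : 2 * k' + r' ≤ g * r') :
    2 * (m * r') < a * r' + 2 * (a * k') := by
  obtain ⟨g, rfl⟩ := Nat.exists_eq_add_of_le hg
  have hgk' : 2 * k' ≤ (g + 1) * r' := by linarith
  have hrel' : m * r' * (g + 1) + a * s = a * k' * (g + 1) + a * k' := by linarith
  have has : 1 ≤ a * s := Nat.mul_pos ha hs
  have h1 : a * (2 * k') ≤ a * ((g + 1) * r') := Nat.mul_le_mul_left _ hgk'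
  refine Nat.lt_of_mul_lt_mul_right (a := g + 1) ?_
  nlinarith

end Parameters

end GSRCode

theorem theorem13
    (g k' r' s n k m a : ℕ) [NeZero n]
    (hr' : 2 ≤ r') (hs : 1 ≤ s) (hsk : s ≤ k') (hg : 2 ≤ g)
    (ha : 1 ≤ a) (har : 2 * a ≤ r')
    (hn : n = g * (k' + r')) (hk : k + r' + s = n)
    (hm : (m : ℚ) = a * (g * k' - s) / (g * r' - r'))
    (hgmax : (g : ℚ) ≥ max (2 * (k' : ℚ) / (r' : ℚ) + 1) (((r' : ℚ) + (s : ℚ) + (a : ℚ)) / 2))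
    -- the generalized simple regenerating code
    {F : Type*} [Field F] [Fintype F] (hq : n < Fintype.card F)
    (α : F) (hα : IsPrimitiveRoot α (Fintype.card F - 1))
    (col : Fin m → Submodule F (ZMod n → F)) (hcol : ∀ t, GSRCode.IsMDS (col t) k)
    (hdiag : GSRCode.IsMDS (GSRCode.diagonalCode m a α) m)
    -- the field of the locally MSR PMDS codes
    {K : Type*} [Field K] :
    -- sub-packetization
    (GSRCode.subpacketization (GSRCode.gsrc n m a α col) : ℚ) < a * (3 / 2 + k' / r') ∧
    -- fault tolerance
    GSRCode.IsFaultTolerance (GSRCode.gsrc n m a α col) (r' + s + a) ∧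
    -- repair of every node by contacting `2 m + a - 1` nodes
    (∀ f : ZMod n,
      GSRCode.IsRepair (GSRCode.gsrc n m a α col) f (GSRCode.gsrcRepair F n m a f) ∧
      GSRCode.nodesContacted (GSRCode.gsrcRepair F n m a f) = 2 * m + a - 1) ∧
    -- comparison with every locally MSR PMDS code
    ∀ D : Submodule K (Fin g × Fin (k' + r') → Fin (r' ^ (k' + r' - 1)) → K),
      GSRCode.IsLocallyMSRPMDS D s →
        GSRCode.storageOverhead (GSRCode.gsrc n m a α col) = GSRCode.storageOverhead D ∧
        GSRCode.subpacketization (GSRCode.gsrc n m a α col) < GSRCode.subpacketization D ∧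
        GSRCode.Tolerates D (r' + s) ∧
        (s < k' → GSRCode.IsFaultTolerance D (r' + s)) ∧
        ∀ (i : Fin g) (h : Fin (k' + r')) (R : GSRCode.Downloads K (Fin (k' + r'))
            (Fin (r' ^ (k' + r' - 1)))),
          GSRCode.IsMSRRepair (GSRCode.groupCode D i) k' h R →
            GSRCode.nodesContacted R = k' + r' - 1 ∧
            ∀ f : ZMod n, GSRCode.nodesContacted (GSRCode.gsrcRepair F n m a f) <
              GSRCode.nodesContacted R := by
  have hr0 : (0 : ℚ) < r' := by exact_mod_cast (by omega : 0 < r')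
  have hrel := GSRCode.param_relation hr' hg hm
  have hgk : 2 * k' + r' ≤ g * r' := by
    have h := (le_max_left _ _).trans hgmax
    rw [← le_sub_iff_add_le, div_le_iff₀ hr0] at h
    have : (2 * k' + r' : ℚ) ≤ g * r' := by linarith
    exact_mod_cast this
  have hgE : r' + s + a ≤ 2 * g := by
    have h := (le_max_right _ _).trans hgmax
    rw [div_le_iff₀ (by norm_num)] at h
    have : (r' + s + a : ℚ) ≤ 2 * g := by linarith
    exact_mod_cast this
  have hlt := GSRCode.param_lt hs hg ha hrel hgk
  have hmain : 2 * m + a < k' + r' := by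
    have h : 2 * a * (k' + r') ≤ r' * (k' + r') := Nat.mul_le_mul_right _ har
    refine Nat.lt_of_mul_lt_mul_right (a := r') ?_
    linarith
  have hsg : s < g * k' := by
    have := Nat.mul_le_mul_right k' hg
    omega
  have hm1 : 1 ≤ m := by
    by_contra hm0
    obtain rfl : m = 0 := by omega
    have : a * s < a * (g * k') := Nat.mul_lt_mul_of_pos_left hsg (by omega)
    rw [zero_mul, zero_mul] at hrel
    omega
  -- for `k' = 1` the equation for `m` reads `m = a / r' ≤ 1 / 2`
  have hk2 : 2 ≤ k' := by
    by_contra hk1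
    obtain ⟨g', hg'⟩ := Nat.exists_eq_add_of_le hg
    have h : m * r' * (1 + g') = a * (1 + g') := by
      rw [show k' = 1 by omega, show s = 1 by omega, hg'] at hrel
      linarith
    have h' := Nat.eq_of_mul_eq_mul_right (by omega) h
    have := Nat.mul_le_mul_right r' hm1
    omega
  have hn1 : 2 * (k' + r') ≤ n := hn ▸ Nat.mul_le_mul_right _ hg
  have hgn : 2 * g < n := by 
    have := Nat.mul_le_mul_left g (show 3 ≤ k' + r' by omega)
    omega
  have hk1 : 1 ≤ k := by omega
  have hcount : 2 * (m + a - 1) * (r' + s + a) < (a + 1) * n := by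
    obtain ⟨b, hb⟩ := Nat.exists_eq_add_of_le ha
    have h1 : 2 * (m + a - 1) * (r' + s + a) ≤ 2 * (m + a - 1) * (2 * g) :=
      Nat.mul_le_mul_left _ hgE
    have h2 : 4 * (m + a - 1) < (a + 1) * (k' + r') := by
      have h3 : (a + 1) * (2 * m + a + 1) ≤ (a + 1) * (k' + r') := Nat.mul_le_mul_left _ hmain
      have h4 : m + a - 1 = m + b := by omega
      have h5 : (a + 1) * (2 * m + a + 1) = 2 * (b * m) + b * b + 4 * (m + b) + 4 := by
        rw [hb]; ring
      rw [h4]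
      omega
    have h5 : 4 * (m + a - 1) * g < (a + 1) * (k' + r') * g :=
      Nat.mul_lt_mul_of_pos_right h2 (by omega)
    calc _ ≤ 2 * (m + a - 1) * (2 * g) := h1
      _ = 4 * (m + a - 1) * g := by ring
      _ < (a + 1) * (k' + r') * g := h5
      _ = (a + 1) * n := by rw [hn]; ring
  have hkr : k + (r' + s) = n := by omega
  have hsub : GSRCode.subpacketization (GSRCode.gsrc n m a α col) = m + a := by
    simp [GSRCode.subpacketization]
  have hcontact : ∀ f : ZMod n, GSRCode.nodesContacted (GSRCode.gsrcRepair F n m a f) =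
      2 * m + a - 1 := GSRCode.nodesContacted_gsrcRepair hm1 ha (by omega)
  have hℓ : 0 < r' ^ (k' + r' - 1) := by positivity
  refine ⟨?_, ?_, fun f => ⟨GSRCode.isRepair_gsrcRepair hm1 ha (by omega) f, hcontact f⟩, ?_⟩
  · have h : (2 * (m * r') : ℚ) < a * r' + 2 * (a * k') := by exact_mod_cast hlt
    rw [hsub, ← mul_lt_mul_iff_left₀ hr0]
    have : (a * (3 / 2 + k' / r') * r' : ℚ) = a * (3 / 2 * r' + k') := by field_simp
    rw [this]
    push_cast
    linarith
  · obtain ⟨E, hE, hE'⟩ := GSRCode.exists_gsrc_not_recoverable (α := α) (a := a) hcol hm1 hkr hk1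
    exact GSRCode.isFaultTolerance_of_not_recoverable
      (GSRCode.gsrc_tolerates hcol hdiag hm1 hkr (by omega) (by omega) hcount) hE hE'
  · intro D hD
    refine ⟨?_, ?_, hD.tolerates, fun hsk' => ?_, fun i h R hR => ?_⟩
    · unfold GSRCode.storageOverhead
      rw [GSRCode.finrank_gsrc hcol, hD.finrank_eq]
      simp only [ZMod.card, Fintype.card_sum, Fintype.card_fin, Fintype.card_prod]
      have hmk : 0 < m * k := Nat.mul_pos hm1 hk1
      have hdim : 0 < (g * k' - s) * r' ^ (k' + r' - 1) := Nat.mul_pos (by omega) hℓ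
      rw [div_eq_div_iff (by exact_mod_cast hmk.ne') (by exact_mod_cast hdim.ne')]
      norm_cast
      -- `(m + a) (g k' - s) = m k`, as `k = (g k' - s) + r' (g - 1)`
      obtain ⟨u, hu⟩ := Nat.exists_eq_add_of_lt hsg
      have hus : g * k' - s = u + 1 := by omega
      have hkey : (m + a) * (u + 1) = m * k := by
        have e1 : k + r' = (u + 1) + g * r' := by
          have : n = g * k' + g * r' := by rw [hn]; ring
          omega
        have e2 : m * k + m * r' = m * (u + 1) + m * (g * r') := by rw [← mul_add, e1]; ring
        have e3 : a * (g * k') = a * s + a * (u + 1) := by rw [hu]; ring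
        have e4 : (m + a) * (u + 1) = m * (u + 1) + a * (u + 1) := by ring
        omega
      rw [hus, ← hn, ← hkey]
      ring
    · rw [hsub]
      have h1 : k' + r' - 1 < r' ^ (k' + r' - 1) := Nat.lt_pow_self (by omega)
      simp only [GSRCode.subpacketization, Fintype.card_fin]
      omega
    · obtain ⟨E, hE, hE'⟩ := hD.exists_not_recoverable (by omega) hsk' hℓ
      exact GSRCode.isFaultTolerance_of_not_recoverable hD.tolerates hE hE'
    · have hcR : GSRCode.nodesContacted R = k' + r' - 1 := by
        have := hR.nodesContacted_eq (hD.group_msr i).1 hk2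
          (by rw [Fintype.card_fin]; omega) (by rwa [Fintype.card_fin])
        rwa [Fintype.card_fin] at this
      refine ⟨hcR, fun f => ?_⟩
      rw [hcontact, hcR]
      omega
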